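/- Fix $p\in(0,1)$. For $\nu\in\mathbb N$ let $n=n_\nu=\binom{\nu}{2}$, identify the coordinates of $\{0,1\}^n$ with the potential edges of a simple graph on $\nu$ vertices, let $S(x)=\sum_i x_i$, and let $\pi_\nu(x)=p^{S(x)}(1-p)^{n-S(x)}$ be the Erdős–Rényi law $G(\nu,p)$ on edge indicators $x\in\{0,1\}^n$. The lazy random walk Metropolis chain for $\pi_\nu$ moves as follows: with probability $1/2$ it stays at the current state $x$; otherwise it chooses uniformly one of the $n$ states $y$ that differ from $x$ in exactly one coordinate, moves to $y$ with probability $\min(1,\pi_\nu(y)/\pi_\nu(x))$, and stays at $x$ if the move is rejected (for $n=0$ it stays at its only state). Let $P_\nu$ be its transition matrix, $$d_\nu(t)=\max_{x}\max_{A\subseteq\{0,1\}^n}\bigl(P_\nu^t(x,A)-\pi_\nu(A)\bigr),\qquad t_{\rm mix}^{(\nu)}(\varepsilon)=\min\{t\ge 0: d_\nu(t)\le\varepsilon\},\qquad t_{\rm mix}^{(\nu)}=t_{\rm mix}^{(\nu)}(1/4),$$ where at real times $s$ we write $d_\nu(s)=d_\nu(\max\{0,\lfloor s\rfloor\})$.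 Then the sequence of chains has cutoff at $\tau_\nu=\max\{p,1-p\}\,n\log n$ with a window of size $n$. That is, as $\nu\to\infty$: 1. for every $\varepsilon\in(0,1)$, $\;t_{\rm mix}^{(\nu)}(\varepsilon)/t_{\rm mix}^{(\nu)}(1-\varepsilon)\to 1$; 2. for $T_\nu=t_{\rm mix}^{(\nu)}$, and also for $T_\nu=\tau_\nu$, one has $n=o(T_\nu)$ and $$\lim_{\alpha\to\infty}\liminf_{\nu\to\infty} d_\nu(T_\nu-\alpha n)=1,\qquad \lim_{\alpha\to\infty}\limsup_{\nu\to\infty} d_\nu(T_\nu+\alpha n)=0 .$$ -/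

import Mathlib

open Filter Topology Asymptotics

noncomputable section

namespace MetropolisCutoff

section Chains

variable {X : Type*} [Fintype X] [DecidableEq X]

/-- Total variation distance of two mass functions on a finite set:
`max_A (μ(A) - ρ(A))` over all subsets `A`. -/
def tvDist (μ ρ : X → ℝ) : ℝ :=
  ⨆ A : Finset X, (∑ y ∈ A, μ y - ∑ y ∈ A, ρ y)

/-- Distance to stationarity after `t` steps from the worst starting point:
`d(t) = max_x ‖P^t(x,·) - π‖_TV`. -/
def worstDist (P : Matrix X X ℝ) (π : X → ℝ) (t : ℕ) : ℝ :=
  ⨆ x : X, tvDist ((P ^ t) x) π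

end Chains

/-- The mixing time `t_mix(ε) = min {t ≥ 0 : d(t) ≤ ε}`. -/
def mixingTime (d : ℕ → ℝ) (ε : ℝ) : ℕ := sInf {t : ℕ | d t ≤ ε}

/-- A sequence of chains, with distances to stationarity `d k t` (`k`-th chain, time `t`),
has a cutoff: for all `ε ∈ (0,1)`, the ratio `t_mix(ε) / t_mix(1 - ε)` tends to `1`. -/
def HasCutoff (d : ℕ → ℕ → ℝ) : Prop :=
  ∀ ε : ℝ, 0 < ε → ε < 1 →
    Tendsto (fun k => (mixingTime (d k) ε : ℝ) / (mixingTime (d k) (1 - ε) : ℝ)) atTop (𝓝 1)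

/-- `d` drops from `1` to `0` around the times `τ k` within a window of size `w k`. Here
`w = o(τ)`, and real times are rounded down to integers (negative times count as `0`; for
each fixed `α` the times `τ k - α * w k` are eventually nonnegative when `w = o(τ)`). -/
structure DropsAt (d : ℕ → ℕ → ℝ) (τ w : ℕ → ℝ) : Prop where
  window : w =o[atTop] τ
  before : Tendsto (fun α : ℝ => liminf (fun k => d k ⌊τ k - α * w k⌋₊) atTop) atTop (𝓝 1)
  after : Tendsto (fun α : ℝ => limsup (fun k => d k ⌊τ k + α * w k⌋₊) atTop) atTop (𝓝 0)

/-- The sequence of chains has cutoff at `τ` with a window of size `w`: it has a cutoff, with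
window size `w` around the mixing time `t_mix = t_mix(1/4)`, and the same window limits hold
around the explicit times `τ`. -/
structure HasCutoffAt (d : ℕ → ℕ → ℝ) (τ w : ℕ → ℝ) : Prop where
  cutoff : HasCutoff d
  window_tmix : DropsAt d (fun k => (mixingTime (d k) (1 / 4) : ℝ)) w
  window_at : DropsAt d τ w

section Hypercube

variable {ι : Type*} [Fintype ι] [DecidableEq ι]

/-- Off-diagonal entries of the random walk Metropolis kernel on the hypercube `{0,1}^ι`: propose
a uniformly chosen neighbour `y` of `x` and accept it with probability `min(1, π(y)/π(x))`. -/
def metropolisMove (π : (ι → Bool) → ℝ) (x y : ι → Bool) : ℝ :=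
  if hammingDist x y = 1 then (1 / (Fintype.card ι : ℝ)) * min 1 (π y / π x) else 0

/-- The random walk Metropolis kernel for `π`; rejected proposals stay at `x`. -/
def metropolis (π : (ι → Bool) → ℝ) : Matrix (ι → Bool) (ι → Bool) ℝ := fun x y =>
  if x = y then 1 - ∑ z, metropolisMove π x z else metropolisMove π x y

/-- The lazy chain: with probability `1/2` stay, otherwise make a Metropolis step. -/
def lazyMetropolis (π : (ι → Bool) → ℝ) : Matrix (ι → Bool) (ι → Bool) ℝ :=
  (1 / 2 : ℝ) • (1 : Matrix (ι → Bool) (ι → Bool) ℝ) + (1 / 2 : ℝ) • metropolis π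

/-- The number of ones `S(x)`. -/
def numOnes (x : ι → Bool) : ℕ := (Finset.univ.filter fun i => x i = true).card

/-- `π(x) = p^{S(x)} (1-p)^{n-S(x)}` with `n` the number of coordinates. -/
def bernoulliMass (p : ℝ) (x : ι → Bool) : ℝ :=
  p ^ numOnes x * (1 - p) ^ (Fintype.card ι - numOnes x)

end Hypercube

/-- The potential edges of a simple graph on `ν` vertices: unordered pairs of distinct vertices. -/
abbrev PotentialEdge (ν : ℕ) : Type := {e : Sym2 (Fin ν) // ¬ e.IsDiag}

theorem card_potentialEdge (ν : ℕ) : Fintype.card (PotentialEdge ν) = ν.choose 2 := by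
  rw [Sym2.card_subtype_not_diag, Fintype.card_fin]

/-- Graphs on `ν` vertices, as edge indicator vectors in `{0,1}^n`, `n = ν.choose 2`. -/
abbrev GraphSpace (ν : ℕ) : Type := PotentialEdge ν → Bool

/-- The Erdős–Rényi law `G(ν,p)` on edge indicators. -/
def erdosRenyi (ν : ℕ) (p : ℝ) : GraphSpace ν → ℝ := bernoulliMass p

/-- Worst-case distance to stationarity of the lazy random walk Metropolis chain for `G(ν,p)`. -/
def erdosRenyiDist (p : ℝ) (ν t : ℕ) : ℝ :=
  worstDist (lazyMetropolis (erdosRenyi ν p)) (erdosRenyi ν p) t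

end MetropolisCutoff

end

/-!
The law `G(ν, p)` is a product measure, so an acceptance probability of the Metropolis chain depends
on the flipped coordinate only. In the lazy chain that coordinate is in effect resampled from its
law with probability `r = 1 / (2 max(p, 1 - p))` (`accept_mul_centred_sub`). Hence the products
`∏ i ∈ S, (x i - p)` are eigenfunctions, with eigenvalues `1 - r |S| / n`
(`sum_lazyMetropolis_mul_character`), and they are complete (`bernoulliMass_mul_sum_character`).

For the upper bound, the `χ²`-distance at time `t` is the sum over nonempty `S` of
`(1 - r |S| / n) ^ (2 t)` times squared eigenfunctions, which is at most
`(1 + exp (-2 r t / n) / (p (1 - p))) ^ n - 1` (`worstDist_le`). Since `2 r max(p, 1 - p) = 1`, this is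
small as soon as `t` exceeds `max(p, 1 - p) n log n` by a large multiple of `n`.

For the lower bound, the statistic `∑ i, (x i - p)` is compared under the law of the chain started
from all ones and under the stationary law. Its means are `n (1 - p) (1 - r / n) ^ t` and `0`. Its
variance is at most `n` in both cases: the stationary coordinates are independent, and at time `t`
distinct coordinates are nonpositively correlated because the eigenvalue `1 - 2 r / n` of pairs is at
most the square of the eigenvalue `1 - r / n` of single coordinates. Chebyshev's inequality separates the two laws when `t` is below `max(p, 1 - p) n log n` by a large multiple of `n`
(`le_worstDist`).

Both bounds hold for all large `ν`, with an error depending only on the number `α` of windows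
(`dropBound_erdosRenyiDist`). As the distance is nonincreasing in time, such a two-sided bound
places every mixing time within a bounded number of windows of the cutoff time, and all the asserted
limits follow (`DropBound.hasCutoffAt`).
-/

open Filter Topology Asymptotics

namespace MetropolisCutoff

/-! ### Cutoff from two-sided bounds -/

section Abstract

theorem mixingTime_le {d : ℕ → ℝ} {ε : ℝ} {t : ℕ} (h : d t ≤ ε) : mixingTime d ε ≤ t :=
  Nat.sInf_le h

theorem lt_mixingTime {d : ℕ → ℝ} (hd : Antitone d) {ε : ℝ} {s t : ℕ} (hs : ε < d s)
    (ht : d t ≤ ε) : s < mixingTime d ε := by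
  by_contra! hle
  have hmem : d (mixingTime d ε) ≤ ε := Nat.sInf_mem (s := {t : ℕ | d t ≤ ε}) ⟨t, ht⟩
  exact absurd ((hd hle).trans hmem) (not_le.2 hs)

/-- A uniform form of `DropsAt`: the distance is within `g α` of `1` at time `τ - α w` and within
`g α` of `0` at time `τ + α w`, once the index is large (depending on `α`). -/
structure DropBound (d : ℕ → ℕ → ℝ) (τ w : ℕ → ℝ) (g : ℝ → ℝ) : Prop where
  lower : ∀ᶠ α in atTop, ∀ᶠ k in atTop, 1 - g α ≤ d k ⌊τ k - α * w k⌋₊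
  upper : ∀ᶠ α in atTop, ∀ᶠ k in atTop, d k ⌊τ k + α * w k⌋₊ ≤ g α

variable {d : ℕ → ℕ → ℝ} {τ w : ℕ → ℝ} {g : ℝ → ℝ}

theorem DropBound.dropsAt (h : DropBound d τ w g) (hg : Tendsto g atTop (𝓝 0))
    (hw : w =o[atTop] τ) (h0 : ∀ k t, 0 ≤ d k t) (h1 : ∀ k t, d k t ≤ 1) : DropsAt d τ w := by
  have bb (u : ℕ → ℕ) : IsBoundedUnder (· ≥ ·) atTop (fun k => d k (u k)) :=
    isBoundedUnder_of ⟨0, fun k => h0 k _⟩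
  have ba (u : ℕ → ℕ) : IsBoundedUnder (· ≤ ·) atTop (fun k => d k (u k)) :=
    isBoundedUnder_of ⟨1, fun k => h1 k _⟩
  refine ⟨hw, ?_, ?_⟩
  · have hl : Tendsto (fun α => 1 - g α) atTop (𝓝 1) := by simpa using hg.const_sub 1
    refine tendsto_of_tendsto_of_tendsto_of_le_of_le' hl tendsto_const_nhds ?_ ?_
    · filter_upwards [h.lower] with α hα
      exact le_liminf_of_le (ba _).isCoboundedUnder_ge hα
    · refine Eventually.of_forall fun α => ?_
      exact liminf_le_of_le (bb _) fun b hb => by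
        obtain ⟨k, hk⟩ := hb.exists
        exact hk.trans (h1 _ _)
  · refine tendsto_of_tendsto_of_tendsto_of_le_of_le' tendsto_const_nhds hg ?_ ?_
    · refine Eventually.of_forall fun α => ?_
      exact le_limsup_of_le (ba _) fun b hb => by
        obtain ⟨k, hk⟩ := hb.exists
        exact (h0 _ _).trans hk
    · filter_upwards [h.upper] with α hα
      exact limsup_le_of_le (bb _).isCoboundedUnder_le hα

/-- Every mixing time stays within a bounded number of windows of `τ`. -/
theorem DropBound.abs_mixingTime_sub_le (h : DropBound d τ w g) (hg : Tendsto g atTop (𝓝 0))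
    (hd : ∀ k, Antitone (d k)) {ε : ℝ} (hε0 : 0 < ε) (hε1 : ε < 1)
    (hτ : ∀ c : ℝ, ∀ᶠ k in atTop, 0 ≤ τ k + c * w k) :
    ∃ α : ℝ, ∀ᶠ k in atTop, |(mixingTime (d k) ε : ℝ) - τ k| ≤ α * w k := by
  have e1 : ∀ᶠ α in atTop, g α < ε := hg.eventually_lt_const hε0
  have e2 : ∀ᶠ α in atTop, g α < 1 - ε := hg.eventually_lt_const (by linarith)
  obtain ⟨α, h1, h2, hl, hu⟩ := (e1.and (e2.and (h.lower.and h.upper))).exists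
  refine ⟨α, ?_⟩
  filter_upwards [hl, hu, hτ α] with k hlk huk hk
  have hup : (mixingTime (d k) ε : ℝ) ≤ τ k + α * w k :=
    (Nat.cast_le.2 (mixingTime_le (huk.trans h1.le))).trans (Nat.floor_le hk)
  have hlow : τ k - α * w k < mixingTime (d k) ε := by
    have hlt := lt_mixingTime (hd k) (ε := ε) ((show ε < _ by linarith).trans_le hlk) (huk.trans h1.le)
    refine (Nat.lt_floor_add_one _).trans_le ?_
    exact_mod_cast hlt
  rw [abs_le]
  constructor <;> linarith

/-- The uniform bounds survive a change of `τ` by a bounded number of windows. -/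
theorem DropBound.shift (h : DropBound d τ w g) (hd : ∀ k, Antitone (d k)) {T : ℕ → ℝ} {c : ℝ}
    (hT : ∀ᶠ k in atTop, |T k - τ k| ≤ c * w k) :
    DropBound d T w (fun α => g (α - c)) := by
  have hsub : Tendsto (fun α : ℝ => α - c) atTop atTop := tendsto_atTop_add_const_right _ _ tendsto_id
  refine ⟨?_, ?_⟩
  · filter_upwards [hsub.eventually h.lower] with α hα
    filter_upwards [hα, hT] with k hk hTk
    refine hk.trans (hd k (Nat.floor_mono ?_))
    have := (abs_le.1 hTk).2
    linarith
  · filter_upwards [hsub.eventually h.upper] with α hα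
    filter_upwards [hα, hT] with k hk hTk
    refine (hd k (Nat.floor_mono ?_)).trans hk
    have := (abs_le.1 hTk).1
    linarith

theorem isEquivalent_of_abs_sub_le {T : ℕ → ℝ} {c : ℝ} (hw : w =o[atTop] τ)
    (hT : ∀ᶠ k in atTop, |T k - τ k| ≤ c * w k) : T ~[atTop] τ := by
  have : (T - τ) =O[atTop] w := by
    refine IsBigO.of_bound |c| ?_
    filter_upwards [hT] with k hk
    rw [Real.norm_eq_abs, Real.norm_eq_abs, ← abs_mul]
    exact hk.trans (le_abs_self _)
  exact this.trans_isLittleO hw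

theorem DropBound.hasCutoffAt (h : DropBound d τ w g) (hg : Tendsto g atTop (𝓝 0))
    (hw : w =o[atTop] τ) (hτ : Tendsto τ atTop atTop) (h0 : ∀ k t, 0 ≤ d k t)
    (h1 : ∀ k t, d k t ≤ 1) (hd : ∀ k, Antitone (d k)) : HasCutoffAt d τ w := by
  have hτc : ∀ c : ℝ, ∀ᶠ k in atTop, 0 ≤ τ k + c * w k := by
    intro c
    have : (fun k => c * w k) =o[atTop] τ := hw.const_mul_left c
    filter_upwards [this.bound one_pos, hτ.eventually_ge_atTop 0] with k hk hk0
    rw [Real.norm_eq_abs, Real.norm_eq_abs, abs_of_nonneg hk0, one_mul] at hk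
    linarith [(abs_le.1 hk).1]
  have heq : ∀ ε : ℝ, 0 < ε → ε < 1 → (fun k => (mixingTime (d k) ε : ℝ)) ~[atTop] τ := by
    intro ε hε0 hε1
    obtain ⟨α, hα⟩ := h.abs_mixingTime_sub_le hg hd hε0 hε1 hτc
    exact isEquivalent_of_abs_sub_le hw hα
  refine ⟨?_, ?_, h.dropsAt hg hw h0 h1⟩
  · intro ε hε0 hε1
    have hE := (heq ε hε0 hε1).trans (heq (1 - ε) (by linarith) (by linarith)).symm
    refine (isEquivalent_iff_tendsto_one ?_).1 hE
    have := (heq (1 - ε) (by linarith) (by linarith)).symm.tendsto_atTop hτ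
    exact this.eventually_ne_atTop 0
  · obtain ⟨c, hc⟩ := h.abs_mixingTime_sub_le hg hd (ε := 1 / 4) (by norm_num) (by norm_num) hτc
    refine (h.shift hd hc).dropsAt ?_ ?_ h0 h1
    · exact hg.comp (tendsto_atTop_add_const_right _ _ tendsto_id)
    · exact hw.trans_isBigO (heq (1 / 4) (by norm_num) (by norm_num)).symm.isBigO

end Abstract

/-! ### Total variation distance of finite chains -/

section Stochastic

variable {X : Type*} [Fintype X]

theorem le_tvDist (μ ρ : X → ℝ) (A : Finset X) :
    ∑ y ∈ A, μ y - ∑ y ∈ A, ρ y ≤ tvDist μ ρ :=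
  le_ciSup (f := fun A : Finset X => ∑ y ∈ A, μ y - ∑ y ∈ A, ρ y) (Set.finite_range _).bddAbove A

theorem tvDist_le_worstDist [DecidableEq X] (P : Matrix X X ℝ) (π : X → ℝ) (t : ℕ) (x : X) :
    tvDist ((P ^ t) x) π ≤ worstDist P π t :=
  le_ciSup (f := fun x => tvDist ((P ^ t) x) π) (Set.finite_range _).bddAbove x

theorem worstDist_nonneg [DecidableEq X] (P : Matrix X X ℝ) (π : X → ℝ) (t : ℕ) : 0 ≤ worstDist P π t := by
  refine Real.iSup_nonneg fun x => ?_
  simpa using le_tvDist ((P ^ t) x) π ∅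

theorem worstDist_le_one [DecidableEq X] [Nonempty X] {P : Matrix X X ℝ} (hP : P ∈ Matrix.rowStochastic ℝ X)
    {π : X → ℝ} (hπ : ∀ x, 0 ≤ π x) (t : ℕ) : worstDist P π t ≤ 1 := by
  have hPt := pow_mem hP t
  refine ciSup_le fun x => ciSup_le fun A => ?_
  have e1 : ∑ y ∈ A, (P ^ t) x y ≤ ∑ y, (P ^ t) x y :=
    Finset.sum_le_sum_of_subset_of_nonneg (Finset.subset_univ _) fun y _ _ => hPt.1 x y
  rw [Matrix.sum_row_of_mem_rowStochastic hPt] at e1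
  linarith [Finset.sum_nonneg fun y (_ : y ∈ A) => hπ y]

/-- The distance decreases because the law at time `t + 1` is a mixture of the laws at time `t`
started from the possible first steps. -/
theorem worstDist_antitone [DecidableEq X] [Nonempty X] {P : Matrix X X ℝ} (hP : P ∈ Matrix.rowStochastic ℝ X)
    (π : X → ℝ) : Antitone (worstDist P π) := by
  refine antitone_nat_of_succ_le fun t => ?_
  refine ciSup_le fun x => ciSup_le fun A => ?_
  have hrow := Matrix.sum_row_of_mem_rowStochastic hP x
  have hz : ∀ z, ∑ y ∈ A, (P ^ t) z y - ∑ y ∈ A, π y ≤ worstDist P π t := fun z =>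
    (le_tvDist _ _ A).trans (tvDist_le_worstDist P π t z)
  calc ∑ y ∈ A, (P ^ (t + 1)) x y - ∑ y ∈ A, π y
      = ∑ z, P x z * (∑ y ∈ A, (P ^ t) z y - ∑ y ∈ A, π y) := by
        simp_rw [mul_sub, Finset.sum_sub_distrib, ← Finset.sum_mul, hrow, one_mul, pow_succ',
          Matrix.mul_apply, Finset.mul_sum]
        rw [Finset.sum_comm]
    _ ≤ ∑ z, P x z * worstDist P π t :=
        Finset.sum_le_sum fun z _ => mul_le_mul_of_nonneg_left (hz z) (hP.1 x z)
    _ = worstDist P π t := by rw [← Finset.sum_mul, hrow, one_mul]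

/-- Total variation is bounded by the `χ²`-distance. -/
theorem tvDist_le_sqrt {μ π : X → ℝ} (hπ : ∀ x, 0 < π x) (hπ1 : ∑ x, π x = 1)
    (hμ1 : ∑ x, μ x = 1) : tvDist μ π ≤ √(∑ y, μ y ^ 2 / π y - 1) := by
  have hchi : ∑ y, (μ y - π y) ^ 2 / π y = ∑ y, μ y ^ 2 / π y - 1 := by
    have : ∀ y, (μ y - π y) ^ 2 / π y = μ y ^ 2 / π y - 2 * μ y + π y := fun y => by
      have := (hπ y).ne'
      field_simp
      ring
    simp_rw [this, Finset.sum_add_distrib, Finset.sum_sub_distrib, ← Finset.mul_sum, hπ1, hμ1]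
    ring
  refine ciSup_le fun A => Real.le_sqrt_of_sq_le ?_
  rw [← hchi, ← Finset.sum_sub_distrib]
  have hA : ∑ y ∈ A, π y ≤ 1 := hπ1 ▸
    Finset.sum_le_sum_of_subset_of_nonneg (Finset.subset_univ _) fun y _ _ => (hπ y).le
  have hA' : ∑ y ∈ A, (μ y - π y) ^ 2 / π y ≤ ∑ y, (μ y - π y) ^ 2 / π y :=
    Finset.sum_le_sum_of_subset_of_nonneg (Finset.subset_univ _) fun y _ _ =>
      div_nonneg (sq_nonneg _) (hπ y).le
  have hcs : (∑ y ∈ A, (μ y - π y)) ^ 2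
      ≤ (∑ y ∈ A, (μ y - π y) ^ 2 / π y) * ∑ y ∈ A, π y := by
    refine Finset.sum_sq_le_sum_mul_sum_of_sq_le_mul A
      (fun y _ => div_nonneg (sq_nonneg _) (hπ y).le) (fun y _ => (hπ y).le) fun y _ => ?_
    rw [div_mul_cancel₀ _ (hπ y).ne']
  refine hcs.trans ((mul_le_of_le_one_right ?_ hA).trans hA')
  exact Finset.sum_nonneg fun y _ => div_nonneg (sq_nonneg _) (hπ y).le

/-- Chebyshev's inequality around an arbitrary centre `b`. -/
theorem sum_le_div_sq_of_le_abs_sub {μ f : X → ℝ} (hμ : ∀ x, 0 ≤ μ x) {b V h : ℝ} (hh : 0 < h)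
    (hV : ∑ y, μ y * (f y - b) ^ 2 ≤ V) {A : Finset X} (hA : ∀ y ∈ A, h ≤ |f y - b|) :
    ∑ y ∈ A, μ y ≤ V / h ^ 2 := by
  rw [le_div_iff₀ (by positivity), Finset.sum_mul]
  calc ∑ y ∈ A, μ y * h ^ 2 ≤ ∑ y ∈ A, μ y * (f y - b) ^ 2 := by
        refine Finset.sum_le_sum fun y hy => mul_le_mul_of_nonneg_left ?_ (hμ y)
        rw [← sq_abs (f y - b)]
        exact pow_le_pow_left₀ hh.le (hA y hy) 2
    _ ≤ ∑ y, μ y * (f y - b) ^ 2 :=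
        Finset.sum_le_sum_of_subset_of_nonneg (Finset.subset_univ _) fun y _ _ =>
          mul_nonneg (hμ y) (sq_nonneg _)
    _ ≤ V := hV

/-- Two laws under which a statistic has means `m` and `0` and variances at most `V` are
distinguished by the event that the statistic exceeds `m / 2`. -/
theorem one_sub_le_tvDist [DecidableEq X] {μ π f : X → ℝ} (hμ : ∀ x, 0 ≤ μ x) (hπ : ∀ x, 0 ≤ π x)
    (hμ1 : ∑ x, μ x = 1) {m V : ℝ} (hm : 0 < m) (hVμ : ∑ y, μ y * (f y - m) ^ 2 ≤ V)
    (hVπ : ∑ y, π y * (f y - 0) ^ 2 ≤ V) : 1 - 8 * V / m ^ 2 ≤ tvDist μ π := by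
  set A := Finset.univ.filter fun y => m / 2 ≤ f y with hA
  have e1 : ∑ y ∈ A, π y ≤ V / (m / 2) ^ 2 :=
    sum_le_div_sq_of_le_abs_sub hπ (by positivity) hVπ fun y hy => by
      have := (Finset.mem_filter.1 hy).2
      rw [sub_zero]
      exact this.trans (le_abs_self _)
  have e2 : ∑ y ∈ Aᶜ, μ y ≤ V / (m / 2) ^ 2 :=
    sum_le_div_sq_of_le_abs_sub hμ (by positivity) hVμ fun y hy => by
      have : f y < m / 2 := by simpa [hA] using hy
      rw [abs_sub_comm]
      exact le_trans (by linarith) (le_abs_self _)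
  have e3 := Finset.sum_add_sum_compl A μ
  have e4 := le_tvDist μ π A
  have e5 : 8 * V / m ^ 2 = 2 * (V / (m / 2) ^ 2) := by field_simp; ring
  rw [hμ1] at e3
  linarith

end Stochastic

/-! ### The lazy Metropolis chain as an operator on functions -/

section Hypercube

variable {ι : Type*} [DecidableEq ι]

/-- The state obtained from `x` by changing the coordinate `i`. -/
def flipAt (x : ι → Bool) (i : ι) : ι → Bool := Function.update x i (!x i)

theorem flipAt_self (x : ι → Bool) (i : ι) : flipAt x i i = !x i := by simp [flipAt]

theorem flipAt_of_ne (x : ι → Bool) {i j : ι} (h : j ≠ i) : flipAt x i j = x j := by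
  simp [flipAt, h]

theorem flipAt_injective (x : ι → Bool) : Function.Injective (flipAt x) := by
  intro i j h
  by_contra hij
  have := congrFun h i
  rw [flipAt_self, flipAt_of_ne x hij] at this
  simp at this

variable [Fintype ι]

theorem filter_hammingDist_eq_one (x : ι → Bool) :
    (Finset.univ.filter fun y => hammingDist x y = 1) = Finset.univ.image (flipAt x) := by
  ext y
  simp only [Finset.mem_filter, Finset.mem_univ, true_and, Finset.mem_image]
  rw [hammingDist, Finset.card_eq_one]
  refine exists_congr fun i => ⟨fun h => ?_, ?_⟩
  · funext j
    have hj : x j ≠ y j ↔ j = i := by simpa using congrArg (j ∈ ·) h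
    rcases eq_or_ne j i with rfl | hji
    · have := hj.2 rfl
      rw [flipAt_self]
      cases hx : x j <;> cases hy : y j <;> simp_all
    · rw [flipAt_of_ne x hji]
      by_contra hne
      exact hji (hj.1 hne)
  · rintro rfl
    ext j
    rcases eq_or_ne j i with rfl | hji
    · simp [flipAt_self]
    · simp [flipAt_of_ne x hji, hji]

theorem sum_metropolisMove_mul (π h : (ι → Bool) → ℝ) (x : ι → Bool) :
    ∑ y, metropolisMove π x y * h y
      = ∑ i, 1 / (Fintype.card ι : ℝ) * min 1 (π (flipAt x i) / π x) * h (flipAt x i) := by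
  simp only [metropolisMove, ite_mul, zero_mul]
  rw [← Finset.sum_filter, filter_hammingDist_eq_one,
    Finset.sum_image fun i _ j _ hij => flipAt_injective x hij]

omit [DecidableEq ι] in
theorem metropolisMove_self (π : (ι → Bool) → ℝ) (x : ι → Bool) : metropolisMove π x x = 0 := by
  simp [metropolisMove]

theorem lazyMetropolis_apply (π : (ι → Bool) → ℝ) (x y : ι → Bool) :
    lazyMetropolis π x y = (if x = y then 1 - 1 / 2 * ∑ z, metropolisMove π x z else 0)
      + 1 / 2 * metropolisMove π x y := by
  simp only [lazyMetropolis, metropolis, Matrix.add_apply, Matrix.smul_apply, Matrix.one_apply,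
    smul_eq_mul]
  split_ifs with h
  · subst h
    rw [metropolisMove_self]
    ring
  · ring

/-- The chain acts on functions as the identity plus a generator that averages the increments
along single flips. -/
theorem lazyMetropolis_mulVec (π h : (ι → Bool) → ℝ) (x : ι → Bool) :
    ∑ y, lazyMetropolis π x y * h y = h x + ∑ i, 1 / (2 * (Fintype.card ι : ℝ)) *
      min 1 (π (flipAt x i) / π x) * (h (flipAt x i) - h x) := by
  have e1 := sum_metropolisMove_mul π h x
  have e2 := sum_metropolisMove_mul π (fun _ => 1) x
  simp only [mul_one] at e2
  have e3 : ∑ i, 1 / (2 * (Fintype.card ι : ℝ)) *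
      min 1 (π (flipAt x i) / π x) * (h (flipAt x i) - h x)
      = 1 / 2 * (∑ i, 1 / (Fintype.card ι : ℝ) * min 1 (π (flipAt x i) / π x) * h (flipAt x i))
        - 1 / 2 * (∑ i, 1 / (Fintype.card ι : ℝ) * min 1 (π (flipAt x i) / π x)) * h x := by
    rw [Finset.mul_sum, Finset.mul_sum, Finset.sum_mul, ← Finset.sum_sub_distrib]
    refine Finset.sum_congr rfl fun i _ => ?_
    rw [one_div_mul_eq_div]
    field_simp
  rw [e3, ← e1, ← e2]
  simp only [lazyMetropolis_apply, add_mul, Finset.sum_add_distrib, ite_mul, zero_mul,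
    Finset.sum_ite_eq, Finset.mem_univ, if_true, mul_assoc, ← Finset.mul_sum]
  ring

theorem lazyMetropolis_mem_rowStochastic {π : (ι → Bool) → ℝ} (hπ : ∀ x, 0 ≤ π x) :
    lazyMetropolis π ∈ Matrix.rowStochastic ℝ (ι → Bool) := by
  rw [Matrix.mem_rowStochastic_iff_sum]
  have hmove : ∀ x y, 0 ≤ metropolisMove π x y := fun x y => by
    unfold metropolisMove
    have := div_nonneg (hπ y) (hπ x)
    split_ifs <;> positivity
  refine ⟨fun x y => ?_, fun x => ?_⟩
  · rw [lazyMetropolis_apply]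
    have hs : ∑ z, metropolisMove π x z ≤ 1 := by
      have e2 := sum_metropolisMove_mul π (fun _ => 1) x
      simp only [mul_one] at e2
      rw [e2]
      calc ∑ i, 1 / (Fintype.card ι : ℝ) * min 1 (π (flipAt x i) / π x)
          ≤ ∑ _i : ι, 1 / (Fintype.card ι : ℝ) :=
            Finset.sum_le_sum fun i _ => mul_le_of_le_one_right (by positivity) (min_le_left _ _)
        _ ≤ 1 := by simpa using mul_inv_le_one
    have := hmove x y
    split_ifs <;> linarith
  · simpa using lazyMetropolis_mulVec π (fun _ => 1) x

/-! ### Spectral decomposition for the Bernoulli law -/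

/-- The mass of a single coordinate under the Bernoulli law. -/
def coordMass (p : ℝ) (b : Bool) : ℝ := if b then p else 1 - p

/-- The centred coordinate, `b - p`. -/
def centred (p : ℝ) (b : Bool) : ℝ := if b then 1 - p else -p

theorem bernoulliMass_eq_prod (p : ℝ) (x : ι → Bool) :
    bernoulliMass p x = ∏ i, coordMass p (x i) := by
  simp only [coordMass]
  rw [Finset.prod_ite, Finset.prod_const, Finset.prod_const, bernoulliMass, numOnes,
    ← Finset.card_univ, Finset.filter_not, Finset.card_sdiff_of_subset (Finset.filter_subset _ _)]

theorem coordMass_pos {p : ℝ} (hp0 : 0 < p) (hp1 : p < 1) (b : Bool) : 0 < coordMass p b := by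
  cases b <;> simp [coordMass, hp0, hp1]

theorem abs_centred_le_one {p : ℝ} (hp0 : 0 < p) (hp1 : p < 1) (b : Bool) :
    |centred p b| ≤ 1 := by
  rw [abs_le]
  cases b <;> simp [centred] <;> constructor <;> linarith

theorem bernoulliMass_pos {p : ℝ} (hp0 : 0 < p) (hp1 : p < 1) (x : ι → Bool) :
    0 < bernoulliMass p x := by
  rw [bernoulliMass_eq_prod]
  exact Finset.prod_pos fun i _ => coordMass_pos hp0 hp1 _

theorem bernoulliMass_flipAt_div {p : ℝ} (hp0 : 0 < p) (hp1 : p < 1) (x : ι → Bool) (i : ι) :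
    bernoulliMass p (flipAt x i) / bernoulliMass p x = coordMass p (!x i) / coordMass p (x i) := by
  have hrest : ∏ j ∈ Finset.univ.erase i, coordMass p (flipAt x i j)
      = ∏ j ∈ Finset.univ.erase i, coordMass p (x j) :=
    Finset.prod_congr rfl fun j hj => by rw [flipAt_of_ne x (Finset.ne_of_mem_erase hj)]
  rw [bernoulliMass_eq_prod, bernoulliMass_eq_prod,
    ← Finset.mul_prod_erase _ _ (Finset.mem_univ i),
    ← Finset.mul_prod_erase _ (fun j => coordMass p (x j)) (Finset.mem_univ i), hrest, flipAt_self]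
  exact mul_div_mul_right _ _ (Finset.prod_pos fun j _ => coordMass_pos hp0 hp1 _).ne'

/-- Flipping a coordinate with half the Metropolis acceptance probability contracts the centred
coordinate at the same rate `1 / (2 max(p, 1 - p))` from both of its values: the move amounts to
resampling the coordinate from its law with that probability. -/
theorem accept_mul_centred_sub {p : ℝ} (hp0 : 0 < p) (hp1 : p < 1) (b : Bool) :
    1 / 2 * min 1 (coordMass p (!b) / coordMass p b) * (centred p (!b) - centred p b)
      = -(1 / (2 * max p (1 - p))) * centred p b := by
  have hq : 0 < 1 - p := by linarith
  rcases le_total p (1 - p) with h | h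
  · rw [max_eq_right h]
    cases b
    · simp only [coordMass, centred, Bool.not_false, if_true, Bool.false_eq_true, if_false]
      rw [min_eq_right ((div_le_one hq).2 h)]
      field_simp
      ring
    · simp only [coordMass, centred, Bool.not_true, if_true, Bool.false_eq_true, if_false]
      rw [min_eq_left ((one_le_div hp0).2 h)]
      field_simp
      ring
  · rw [max_eq_left h]
    cases b
    · simp only [coordMass, centred, Bool.not_false, if_true, Bool.false_eq_true, if_false]
      rw [min_eq_left ((one_le_div hq).2 h)]
      field_simp
      ring
    · simp only [coordMass, centred, Bool.not_true, if_true, Bool.false_eq_true, if_false]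
      rw [min_eq_right ((div_le_one hp0).2 h)]
      field_simp
      ring

/-- The product of the centred coordinates in `S`; these are the eigenfunctions of the chain. -/
def character (p : ℝ) (S : Finset ι) (x : ι → Bool) : ℝ := ∏ i ∈ S, centred p (x i)

/-- The eigenvalue of `character p S` for `k = S.card`. It equals `1` if there are no coordinates,
where the quotient by `0` is `0`. -/
noncomputable def eigval (ι : Type*) [Fintype ι] (p : ℝ) (k : ℕ) : ℝ :=
  1 - 1 / (2 * max p (1 - p)) * k / Fintype.card ι

theorem accept_mul_character_sub {p : ℝ} (hp0 : 0 < p) (hp1 : p < 1) (S : Finset ι)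
    (x : ι → Bool) (i : ι) :
    1 / (2 * (Fintype.card ι : ℝ)) * min 1 (bernoulliMass p (flipAt x i) / bernoulliMass p x) *
        (character p S (flipAt x i) - character p S x)
      = if i ∈ S then -(1 / (2 * max p (1 - p))) / Fintype.card ι * character p S x else 0 := by
  split_ifs with hi
  · have hrest : ∏ j ∈ S.erase i, centred p (flipAt x i j) = ∏ j ∈ S.erase i, centred p (x j) :=
      Finset.prod_congr rfl fun j hj => by rw [flipAt_of_ne x (Finset.ne_of_mem_erase hj)]
    rw [bernoulliMass_flipAt_div hp0 hp1, character, character, ← Finset.mul_prod_erase _ _ hi,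
      ← Finset.mul_prod_erase _ (fun j => centred p (x j)) hi, hrest, flipAt_self]
    have := accept_mul_centred_sub hp0 hp1 (x i)
    linear_combination (1 / (Fintype.card ι : ℝ)) * (∏ j ∈ S.erase i, centred p (x j)) * this
  · have : character p S (flipAt x i) = character p S x :=
      Finset.prod_congr rfl fun j hj => by
        rw [flipAt_of_ne x (ne_of_mem_of_not_mem hj hi)]
    rw [this, sub_self, mul_zero]

theorem sum_lazyMetropolis_mul_character {p : ℝ} (hp0 : 0 < p) (hp1 : p < 1) (S : Finset ι)
    (x : ι → Bool) :
    ∑ y, lazyMetropolis (bernoulliMass p) x y * character p S y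
      = eigval ι p S.card * character p S x := by
  rw [lazyMetropolis_mulVec]
  simp_rw [accept_mul_character_sub hp0 hp1]
  rw [Finset.sum_ite_mem, Finset.univ_inter, Finset.sum_const, nsmul_eq_mul, eigval]
  ring

theorem sum_pow_mul_character {p : ℝ} (hp0 : 0 < p) (hp1 : p < 1) (S : Finset ι) (t : ℕ)
    (x : ι → Bool) :
    ∑ y, (lazyMetropolis (bernoulliMass p) ^ t) x y * character p S y
      = eigval ι p S.card ^ t * character p S x := by
  induction t generalizing x with
  | zero => simp [Matrix.one_apply]
  | succ t ih =>
    simp_rw [pow_succ', Matrix.mul_apply, Finset.sum_mul]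
    rw [Finset.sum_comm]
    simp_rw [mul_assoc, ← Finset.mul_sum, ih]
    calc ∑ z, lazyMetropolis (bernoulliMass p) x z * (eigval ι p S.card ^ t * character p S z)
        = eigval ι p S.card ^ t *
            ∑ z, lazyMetropolis (bernoulliMass p) x z * character p S z := by
          rw [Finset.mul_sum]
          exact Finset.sum_congr rfl fun z _ => by ring
      _ = _ := by
          rw [sum_lazyMetropolis_mul_character hp0 hp1]
          ring

theorem sum_bernoulliMass_mul_character (p : ℝ) (S : Finset ι) :
    ∑ x : ι → Bool, bernoulliMass p x * character p S x = if S = ∅ then 1 else 0 := by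
  have h : ∀ x : ι → Bool, bernoulliMass p x * character p S x
      = ∏ i, coordMass p (x i) * (if i ∈ S then centred p (x i) else 1) := fun x => by
    rw [Finset.prod_mul_distrib, ← bernoulliMass_eq_prod, Finset.prod_ite_mem, Finset.univ_inter,
      character]
  simp_rw [h]
  rw [← Fintype.piFinset_univ, ← Finset.prod_univ_sum
    (f := fun i b => coordMass p b * (if i ∈ S then centred p b else 1))]
  have h2 : ∀ i, ∑ b, coordMass p b * (if i ∈ S then centred p b else 1)
      = if i ∈ S then 0 else 1 := fun i => by
    split_ifs
    · simp [coordMass, centred]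
      ring
    · simp [coordMass]
  simp_rw [h2]
  split_ifs with hS
  · simp [hS]
  · obtain ⟨i, hi⟩ := Finset.nonempty_iff_ne_empty.2 hS
    exact Finset.prod_eq_zero (Finset.mem_univ i) (by simp [hi])

theorem sum_bernoulliMass (p : ℝ) : ∑ x : ι → Bool, bernoulliMass p x = 1 := by
  simpa [character] using sum_bernoulliMass_mul_character (ι := ι) p ∅

/-- Completeness of the characters: the point mass at `x` expanded in them. -/
theorem bernoulliMass_mul_sum_character {p : ℝ} (hp0 : 0 < p) (hp1 : p < 1) (x y : ι → Bool) :
    bernoulliMass p y * ∑ S : Finset ι, (character p S x * character p S y) / (p * (1 - p)) ^ S.card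
      = if x = y then 1 else 0 := by
  have hq : 0 < 1 - p := by linarith
  have h1 : ∀ S : Finset ι, (character p S x * character p S y) / (p * (1 - p)) ^ S.card
      = ∏ i ∈ S, centred p (x i) * centred p (y i) / (p * (1 - p)) := fun S => by
    rw [Finset.prod_div_distrib, Finset.prod_mul_distrib, Finset.prod_const, character, character]
  simp_rw [h1]
  rw [← Finset.powerset_univ, ← Finset.prod_one_add, bernoulliMass_eq_prod,
    ← Finset.prod_mul_distrib]
  have h2 : ∀ i, coordMass p (y i) * (1 + centred p (x i) * centred p (y i) / (p * (1 - p)))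
      = if x i = y i then 1 else 0 := fun i => by
    cases x i <;> cases y i <;> simp [coordMass, centred] <;> field_simp <;> simp
  simp_rw [h2]
  rw [Finset.prod_ite_zero]
  simp [funext_iff]

theorem pow_lazyMetropolis_apply {p : ℝ} (hp0 : 0 < p) (hp1 : p < 1) (t : ℕ) (x y : ι → Bool) :
    (lazyMetropolis (bernoulliMass p) ^ t) x y = bernoulliMass p y *
      ∑ S : Finset ι, eigval ι p S.card ^ t *
        ((character p S x * character p S y) / (p * (1 - p)) ^ S.card) := by
  calc (lazyMetropolis (bernoulliMass p) ^ t) x y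
      = ∑ z, (lazyMetropolis (bernoulliMass p) ^ t) x z * (if z = y then 1 else 0) := by simp
    _ = ∑ z, ∑ S : Finset ι, bernoulliMass p y * character p S y / (p * (1 - p)) ^ S.card *
          ((lazyMetropolis (bernoulliMass p) ^ t) x z * character p S z) := by
        refine Finset.sum_congr rfl fun z _ => ?_
        rw [← bernoulliMass_mul_sum_character hp0 hp1 z y, Finset.mul_sum, Finset.mul_sum]
        exact Finset.sum_congr rfl fun S _ => by ring
    _ = _ := by
        rw [Finset.sum_comm, Finset.mul_sum]
        refine Finset.sum_congr rfl fun S _ => ?_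
        rw [← Finset.mul_sum, sum_pow_mul_character hp0 hp1]
        ring

theorem detailed_balance_pow {p : ℝ} (hp0 : 0 < p) (hp1 : p < 1) (t : ℕ) (x y : ι → Bool) :
    bernoulliMass p x * (lazyMetropolis (bernoulliMass p) ^ t) x y
      = bernoulliMass p y * (lazyMetropolis (bernoulliMass p) ^ t) y x := by
  rw [pow_lazyMetropolis_apply hp0 hp1, pow_lazyMetropolis_apply hp0 hp1]
  simp_rw [mul_comm (character p _ x)]
  ring

/-- By reversibility, the second moment of the density of the law at time `t` is a return
probability at time `2 t`, which the character expansion evaluates. -/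
theorem sum_sq_div_bernoulliMass {p : ℝ} (hp0 : 0 < p) (hp1 : p < 1) (t : ℕ) (x : ι → Bool) :
    ∑ y, (lazyMetropolis (bernoulliMass p) ^ t) x y ^ 2 / bernoulliMass p y
      = ∑ S : Finset ι, eigval ι p S.card ^ (2 * t) *
        (character p S x ^ 2 / (p * (1 - p)) ^ S.card) := by
  have hx := bernoulliMass_pos hp0 hp1 x
  have h : ∀ y, (lazyMetropolis (bernoulliMass p) ^ t) x y ^ 2 / bernoulliMass p y
      = (lazyMetropolis (bernoulliMass p) ^ t) x y *
        (lazyMetropolis (bernoulliMass p) ^ t) y x / bernoulliMass p x := fun y => by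
    have hy := bernoulliMass_pos hp0 hp1 y
    rw [div_eq_div_iff hy.ne' hx.ne']
    linear_combination (lazyMetropolis (bernoulliMass p) ^ t) x y *
      detailed_balance_pow hp0 hp1 t x y
  simp_rw [h]
  rw [← Finset.sum_div, ← Matrix.mul_apply, ← pow_add, ← two_mul, pow_lazyMetropolis_apply hp0 hp1,
    mul_div_cancel_left₀ _ hx.ne']
  simp_rw [sq]

/-! ### Bounds on the distance to stationarity -/

theorem rate_le_one (p : ℝ) : 1 / (2 * max p (1 - p)) ≤ 1 := by
  have := le_max_left p (1 - p)
  have := le_max_right p (1 - p)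
  rw [div_le_one] <;> linarith

omit [DecidableEq ι] in
theorem eigval_nonneg {p : ℝ} {k : ℕ} (hk : k ≤ Fintype.card ι) : 0 ≤ eigval ι p k := by
  have h1 : (1 / (2 * max p (1 - p))) * (k / Fintype.card ι : ℝ) ≤ 1 :=
    mul_le_one₀ (rate_le_one p) (by positivity)
      (div_le_one_of_le₀ (by exact_mod_cast hk) (by positivity))
  rw [eigval, mul_div_assoc]
  linarith

/-- The `χ²` bound, summed over all eigenfunctions. -/
theorem worstDist_le {p : ℝ} (hp0 : 0 < p) (hp1 : p < 1) (t : ℕ) :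
    worstDist (lazyMetropolis (bernoulliMass (ι := ι) p)) (bernoulliMass p) t
      ≤ √(Real.exp (Fintype.card ι * (Real.exp (-(2 * t * (1 / (2 * max p (1 - p))) /
        Fintype.card ι)) / (p * (1 - p)))) - 1) := by
  have hq : 0 < 1 - p := by linarith
  have hst := pow_mem (lazyMetropolis_mem_rowStochastic
    (fun x : ι → Bool => (bernoulliMass_pos hp0 hp1 x).le)) t
  refine ciSup_le fun x => (tvDist_le_sqrt (bernoulliMass_pos hp0 hp1) (sum_bernoulliMass p)
    (Matrix.sum_row_of_mem_rowStochastic hst x)).trans (Real.sqrt_le_sqrt (sub_le_sub_right ?_ 1))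
  rw [sum_sq_div_bernoulliMass hp0 hp1]
  set r := Real.exp (-(2 * t * (1 / (2 * max p (1 - p))) / Fintype.card ι)) / (p * (1 - p))
    with hr
  have hr0 : 0 < r := by positivity
  calc ∑ S : Finset ι, eigval ι p S.card ^ (2 * t) *
        (character p S x ^ 2 / (p * (1 - p)) ^ S.card)
      ≤ ∑ S : Finset ι, r ^ S.card := by
        refine Finset.sum_le_sum fun S _ => ?_
        have h1 : eigval ι p S.card ^ (2 * t)
            ≤ Real.exp (-(2 * t * (1 / (2 * max p (1 - p))) / Fintype.card ι)) ^ S.card := by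
          have := Real.add_one_le_exp (-(1 / (2 * max p (1 - p)) * S.card / Fintype.card ι))
          refine (pow_le_pow_left₀ (eigval_nonneg S.card_le_univ)
            (show eigval ι p S.card ≤ Real.exp (-(1 / (2 * max p (1 - p)) * S.card / Fintype.card ι)) by
              rw [eigval]
              linarith) _).trans ?_
          rw [← Real.exp_nat_mul, ← Real.exp_nat_mul]
          refine Real.exp_le_exp.2 (le_of_eq ?_)
          push_cast
          ring
        have h2 : character p S x ^ 2 ≤ 1 := by
          rw [sq_le_one_iff_abs_le_one, character, Finset.abs_prod]
          exact Finset.prod_le_one (fun _ _ => abs_nonneg _)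
            fun i _ => abs_centred_le_one hp0 hp1 _
        rw [hr, div_pow, ← mul_div_assoc]
        refine div_le_div_of_nonneg_right ?_ (by positivity)
        exact (mul_le_mul h1 h2 (by positivity) (by positivity)).trans_eq (mul_one _)
    _ = (1 + r) ^ Fintype.card ι := by
        rw [← Finset.powerset_univ, ← Finset.card_univ, ← Finset.prod_const, Finset.prod_one_add]
        simp
    _ ≤ Real.exp r ^ Fintype.card ι :=
        pow_le_pow_left₀ (by positivity) (by linarith [Real.add_one_le_exp r]) _
    _ = Real.exp (Fintype.card ι * r) := (Real.exp_nat_mul _ _).symm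

/-- The sum of coordinates with common mean `a`, pairwise nonpositively correlated, has variance at
most the number of coordinates. -/
theorem sum_mul_sum_centred_sub_sq_le {p : ℝ} (hp0 : 0 < p) (hp1 : p < 1)
    {μ : (ι → Bool) → ℝ} (hμ : ∀ x, 0 ≤ μ x) (hμ1 : ∑ x, μ x = 1) {a : ℝ}
    (ha : ∀ i, ∑ y, μ y * centred p (y i) = a)
    (hc : ∀ i j, i ≠ j → ∑ y, μ y * (centred p (y i) * centred p (y j)) ≤ a ^ 2) :
    ∑ y, μ y * (∑ i, centred p (y i) - Fintype.card ι * a) ^ 2 ≤ Fintype.card ι := by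
  have h1 : ∑ y, μ y * ∑ i, centred p (y i) = Fintype.card ι * a := by
    simp_rw [Finset.mul_sum]
    rw [Finset.sum_comm]
    simp [ha]
  have hij : ∀ i j, ∑ y, μ y * (centred p (y i) * centred p (y j))
      ≤ (if i = j then 1 else 0) + a ^ 2 := fun i j => by
    split_ifs with h
    · subst h
      have : ∑ y, μ y * (centred p (y i) * centred p (y i)) ≤ ∑ y, μ y :=
        Finset.sum_le_sum fun y _ => by
          refine mul_le_of_le_one_right (hμ y) ?_
          rw [← sq, sq_le_one_iff_abs_le_one]
          exact abs_centred_le_one hp0 hp1 _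
      nlinarith [sq_nonneg a]
    · simpa using hc i j h
  have h2 : ∑ y, μ y * (∑ i, centred p (y i)) ^ 2
      ≤ Fintype.card ι + (Fintype.card ι * a) ^ 2 := by
    calc ∑ y, μ y * (∑ i, centred p (y i)) ^ 2
        = ∑ i, ∑ j, ∑ y, μ y * (centred p (y i) * centred p (y j)) := by
          simp_rw [sq, Finset.sum_mul_sum, Finset.mul_sum]
          rw [Finset.sum_comm]
          exact Finset.sum_congr rfl fun i _ => Finset.sum_comm
      _ ≤ ∑ i : ι, ∑ j : ι, ((if i = j then 1 else 0) + a ^ 2) :=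
          Finset.sum_le_sum fun i _ => Finset.sum_le_sum fun j _ => hij i j
      _ = _ := by
          simp [Finset.sum_add_distrib]
          ring
  have h3 : ∀ y, μ y * (∑ i, centred p (y i) - Fintype.card ι * a) ^ 2
      = μ y * (∑ i, centred p (y i)) ^ 2
        - 2 * (Fintype.card ι * a) * (μ y * ∑ i, centred p (y i))
        + μ y * (Fintype.card ι * a) ^ 2 := fun y => by ring
  simp_rw [h3, Finset.sum_add_distrib, Finset.sum_sub_distrib, ← Finset.mul_sum, ← Finset.sum_mul,
    h1, hμ1]
  linarith

/-- The second moment bound: the sum of the centred coordinates separates the law of the chain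
started from all ones from the stationary law. -/
theorem le_worstDist {p : ℝ} (hp0 : 0 < p) (hp1 : p < 1) (hn : 2 ≤ Fintype.card ι) (t : ℕ) :
    1 - 8 * Fintype.card ι / (Fintype.card ι * ((1 - p) * eigval ι p 1 ^ t)) ^ 2
      ≤ worstDist (lazyMetropolis (bernoulliMass (ι := ι) p)) (bernoulliMass p) t := by
  have hq : 0 < 1 - p := by linarith
  have hM : 0 < max p (1 - p) := lt_max_of_lt_left hp0
  have hn' : (2 : ℝ) ≤ Fintype.card ι := by exact_mod_cast hn
  have hst := pow_mem (lazyMetropolis_mem_rowStochastic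
    (fun x : ι → Bool => (bernoulliMass_pos hp0 hp1 x).le)) t
  have he1 : 0 < eigval ι p 1 := by
    have h2 : 1 / (2 * max p (1 - p)) / (Fintype.card ι : ℝ) ≤ 1 / 2 :=
      div_le_div₀ zero_le_one (rate_le_one p) two_pos hn'
    rw [eigval, Nat.cast_one, mul_one]
    linarith
  -- Nonpositive correlation of distinct coordinates at time `t` comes from this inequality.
  have he2 : eigval ι p 2 ≤ eigval ι p 1 ^ 2 := by
    simp only [eigval]
    push_cast
    linear_combination sq_nonneg (1 / (2 * max p (1 - p)) / (Fintype.card ι : ℝ))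
  have hpair : ∀ i j : ι, i ≠ j → ∀ y, centred p (y i) * centred p (y j) = character p {i, j} y :=
    fun i j hij y => by rw [character, Finset.prod_pair hij]
  refine le_trans ?_ (tvDist_le_worstDist _ _ t fun _ => true)
  refine one_sub_le_tvDist (f := fun y => ∑ i, centred p (y i)) (fun y => hst.1 _ y)
    (fun y => (bernoulliMass_pos hp0 hp1 y).le) (Matrix.sum_row_of_mem_rowStochastic hst _)
    (by positivity) ?_ ?_
  · refine sum_mul_sum_centred_sub_sq_le hp0 hp1 (fun y => hst.1 _ y)
      (Matrix.sum_row_of_mem_rowStochastic hst _) (fun i => ?_) fun i j hij => ?_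
    · have := sum_pow_mul_character hp0 hp1 {i} t (fun _ => true)
      simp only [character, Finset.prod_singleton, Finset.card_singleton] at this
      rw [this]
      simp only [centred, if_true]
      ring
    · simp_rw [hpair i j hij]
      rw [sum_pow_mul_character hp0 hp1, Finset.card_pair hij, character, Finset.prod_pair hij]
      simp only [centred, if_true]
      have := pow_le_pow_left₀ (eigval_nonneg (p := p) hn) he2 t
      calc eigval ι p 2 ^ t * ((1 - p) * (1 - p))
          ≤ (eigval ι p 1 ^ 2) ^ t * ((1 - p) * (1 - p)) := by gcongr
        _ = _ := by ring
  · have := sum_mul_sum_centred_sub_sq_le hp0 hp1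
      (fun y : ι → Bool => (bernoulliMass_pos hp0 hp1 y).le) (sum_bernoulliMass p) (a := 0)
      (fun i => ?_) fun i j hij => ?_
    · simpa using this
    · simpa [character] using sum_bernoulliMass_mul_character p {i}
    · simp_rw [hpair i j hij]
      rw [sum_bernoulliMass_mul_character]
      simp

end Hypercube

/-! ### The Erdős–Rényi chains -/

section Asymptotic

/-- The rate of contraction is normalized so that `exp (-2 r t / n) = 1 / n` at the cutoff time
`t = max(p, 1 - p) n log n`. -/
theorem two_rate_mul_max {p : ℝ} (hp0 : 0 < p) :
    2 * (1 / (2 * max p (1 - p))) * max p (1 - p) = 1 := by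
  have : max p (1 - p) ≠ 0 := (lt_max_of_lt_left hp0).ne'
  field_simp

/-- The envelope of the distance `α` windows away from the cutoff time: the sum of the `χ²` upper
bound and of the error in the second moment lower bound. -/
noncomputable def cutoffEnvelope (p α : ℝ) : ℝ :=
  √(Real.exp (Real.exp (2 - 2 * (1 / (2 * max p (1 - p))) * α) / (p * (1 - p))) - 1)
    + 8 * Real.exp (1 - 2 * (1 / (2 * max p (1 - p))) * α) / (1 - p) ^ 2

theorem tendsto_cutoffEnvelope {p : ℝ} (hp0 : 0 < p) :
    Tendsto (cutoffEnvelope p) atTop (𝓝 0) := by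
  have hM : 0 < max p (1 - p) := lt_max_of_lt_left hp0
  have hexp : ∀ c : ℝ, Tendsto (fun α => Real.exp (c - 2 * (1 / (2 * max p (1 - p))) * α))
      atTop (𝓝 0) := fun c => by
    refine Real.tendsto_exp_atBot.comp ?_
    simp_rw [sub_eq_add_neg]
    refine tendsto_atBot_add_const_left _ _ (tendsto_neg_atTop_atBot.comp ?_)
    exact tendsto_id.const_mul_atTop (by positivity)
  have h1 := (((Real.continuous_exp.tendsto _).comp
    ((hexp 2).div_const (p * (1 - p)))).sub_const 1).sqrt
  have h2 := ((hexp 1).const_mul 8).div_const ((1 - p) ^ 2)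
  unfold cutoffEnvelope
  simpa [Function.comp_def] using h1.add h2

variable {ι : Type*} [Fintype ι] [DecidableEq ι]

theorem worstDist_le_cutoffEnvelope {p : ℝ} (hp0 : 0 < p) (hp1 : p < 1)
    (hn : 2 ≤ Fintype.card ι) (α : ℝ) :
    worstDist (lazyMetropolis (bernoulliMass (ι := ι) p)) (bernoulliMass p)
      ⌊max p (1 - p) * Fintype.card ι * Real.log (Fintype.card ι) + α * Fintype.card ι⌋₊
      ≤ cutoffEnvelope p α := by
  have hq : 0 < 1 - p := by linarith
  have hM : 0 < max p (1 - p) := lt_max_of_lt_left hp0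
  have hlM := two_rate_mul_max hp0
  have hl1 := rate_le_one p
  refine (worstDist_le hp0 hp1 _).trans (le_trans ?_ (le_add_of_nonneg_right (by positivity)))
  have hn' : (2 : ℝ) ≤ Fintype.card ι := by exact_mod_cast hn
  set n : ℝ := (Fintype.card ι : ℝ)
  set l : ℝ := 1 / (2 * max p (1 - p)) with hl
  have hl0 : 0 < l := by positivity
  have ht := (Nat.sub_one_lt_floor (max p (1 - p) * n * Real.log n + α * n)).le
  set t : ℝ := (⌊max p (1 - p) * n * Real.log n + α * n⌋₊ : ℝ)
  have hn0 : 0 < n := by linarith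
  refine Real.sqrt_le_sqrt (sub_le_sub_right (Real.exp_le_exp.2 ?_) 1)
  rw [← mul_div_assoc]
  refine div_le_div_of_nonneg_right ?_ (by positivity)
  nth_rewrite 1 [← Real.exp_log hn0]
  rw [← Real.exp_add, Real.exp_le_exp]
  -- Rounding the time down costs at most `2 * l / n ≤ 2` in the exponent.
  have h1 : Real.log n + 2 * l * α - 2 ≤ 2 * t * l / n := by
    rw [le_div_iff₀ hn0]
    have h2 := mul_le_mul_of_nonneg_left ht (show 0 ≤ 2 * l by positivity)
    have h3 : 2 * l * (max p (1 - p) * n * Real.log n + α * n - 1)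
        = (Real.log n + 2 * l * α) * n - 2 * l := by
      linear_combination n * Real.log n * hlM
    nlinarith
  linarith

theorem cutoffEnvelope_le_worstDist {p : ℝ} (hp0 : 0 < p) (hp1 : p < 1)
    (hn : 2 ≤ Fintype.card ι) {α : ℝ} (hα : 0 ≤ α)
    (hτ : 0 ≤ max p (1 - p) * Fintype.card ι * Real.log (Fintype.card ι)
      - α * Fintype.card ι) :
    1 - cutoffEnvelope p α ≤ worstDist (lazyMetropolis (bernoulliMass (ι := ι) p)) (bernoulliMass p)
      ⌊max p (1 - p) * Fintype.card ι * Real.log (Fintype.card ι) - α * Fintype.card ι⌋₊ := by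
  have hq : 0 < 1 - p := by linarith
  have hM : 0 < max p (1 - p) := lt_max_of_lt_left hp0
  have hlM := two_rate_mul_max hp0
  have hl1 := rate_le_one p
  refine le_trans ?_ (le_worstDist hp0 hp1 hn _)
  refine sub_le_sub_left (le_trans ?_ (le_add_of_nonneg_left (Real.sqrt_nonneg _))) 1
  have hn' : (2 : ℝ) ≤ Fintype.card ι := by exact_mod_cast hn
  rw [eigval, Nat.cast_one, mul_one]
  have ht := Nat.floor_le hτ
  set n : ℝ := (Fintype.card ι : ℝ)
  set l : ℝ := 1 / (2 * max p (1 - p)) with hl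
  have hl0 : 0 < l := by positivity
  set T : ℕ := ⌊max p (1 - p) * n * Real.log n - α * n⌋₊
  have hn0 : 0 < n := by linarith
  have hnl : 0 < n - l := by linarith
  -- `1 - u ≥ exp (-u / (1 - u))` for `u = l / n`.
  have hbase : Real.exp (-(l / (n - l))) ≤ 1 - l / n := by
    have h1 := Real.add_one_le_exp (l / (n - l))
    have h2 : l / (n - l) + 1 = (1 - l / n)⁻¹ := by
      have : 1 - l / n ≠ 0 := by
        rw [one_sub_div hn0.ne']
        positivity
      field_simp
      ring
    rw [Real.exp_neg]
    rw [h2] at h1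
    have h3 : 0 < 1 - l / n := by
      rw [one_sub_div hn0.ne']
      positivity
    exact inv_le_of_inv_le₀ h3 h1
  have hbase0 : 0 < 1 - l / n := (Real.exp_pos _).trans_le hbase
  have hlog : Real.log n ≤ n - 1 := Real.log_le_sub_one_of_pos hn0
  have hlog0 : 0 ≤ Real.log n := Real.log_nonneg (by linarith)
  -- The correction from `l / n` to `l / (n - l)` in the exponent is `O(log n / n)`.
  have hexpo : 2 * (T : ℝ) * (l / (n - l)) ≤ Real.log n - 2 * l * α + 1 := by
    rw [← mul_div_assoc, div_le_iff₀ hnl]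
    have h2 := mul_le_mul_of_nonneg_left ht (show 0 ≤ 2 * l by positivity)
    have h3 : 2 * l * (max p (1 - p) * n * Real.log n - α * n)
        = (Real.log n - 2 * l * α) * n := by
      linear_combination n * Real.log n * hlM
    have h4 : l * Real.log n ≤ 1 * (n - 1) := mul_le_mul hl1 hlog hlog0 zero_le_one
    have h5 : 0 ≤ l * (2 * l * α) := by positivity
    linarith
  have hmain : Real.exp (2 * l * α - 1) ≤ n * ((1 - l / n) ^ T) ^ 2 := by
    calc Real.exp (2 * l * α - 1) ≤ Real.exp (Real.log n + (2 * T : ℕ) * -(l / (n - l))) := by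
          rw [Real.exp_le_exp]
          push_cast
          linarith
      _ = n * Real.exp (-(l / (n - l))) ^ (2 * T) := by
          rw [Real.exp_add, Real.exp_log hn0, Real.exp_nat_mul]
      _ ≤ n * (1 - l / n) ^ (2 * T) := by gcongr
      _ = n * ((1 - l / n) ^ T) ^ 2 := by rw [← pow_mul, mul_comm T 2]
  have hneg : Real.exp (1 - 2 * l * α) = 1 / Real.exp (2 * l * α - 1) := by
    rw [one_div, ← Real.exp_neg, neg_sub]
  calc 8 * n / (n * ((1 - p) * (1 - l / n) ^ T)) ^ 2
      = 8 * (1 / (n * ((1 - l / n) ^ T) ^ 2)) / (1 - p) ^ 2 := by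
        field_simp
    _ ≤ 8 * Real.exp (1 - 2 * l * α) / (1 - p) ^ 2 := by
        rw [hneg]
        gcongr

theorem tendsto_choose_two : Tendsto (fun ν : ℕ => (ν.choose 2 : ℝ)) atTop atTop := by
  refine tendsto_natCast_atTop_atTop.comp
    (tendsto_atTop_mono' _ ?_ (tendsto_sub_atTop_nat 1))
  filter_upwards [eventually_ge_atTop 2] with ν hν
  rw [Nat.choose_two_right, Nat.le_div_iff_mul_le two_pos, mul_comm]
  exact Nat.mul_le_mul_right _ hν

theorem isLittleO_mul_log {M : ℝ} (hM : 0 < M) {w : ℕ → ℝ} (hw : Tendsto w atTop atTop) :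
    w =o[atTop] fun k => M * w k * Real.log (w k) := by
  have h : (fun _ : ℕ => (1 : ℝ)) =o[atTop] fun k => Real.log (w k) :=
    (isLittleO_one_left_iff ℝ).2 (tendsto_norm_atTop_atTop.comp (Real.tendsto_log_atTop.comp hw))
  have h2 := (isBigO_refl w atTop).mul_isLittleO h
  simp only [mul_one] at h2
  refine (h2.const_mul_right hM.ne').congr_right fun k => by ring

theorem dropBound_erdosRenyiDist {p : ℝ} (hp0 : 0 < p) (hp1 : p < 1) :
    DropBound (erdosRenyiDist p)
      (fun ν : ℕ => max p (1 - p) * (ν.choose 2 : ℝ) * Real.log (ν.choose 2 : ℝ))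
      (fun ν : ℕ => (ν.choose 2 : ℝ)) (cutoffEnvelope p) := by
  have hM : 0 < max p (1 - p) := lt_max_of_lt_left hp0
  refine ⟨?_, ?_⟩
  · filter_upwards [eventually_ge_atTop 0] with α hα
    filter_upwards [tendsto_choose_two.eventually_ge_atTop 2,
      (Real.tendsto_log_atTop.comp tendsto_choose_two).eventually_ge_atTop (α / max p (1 - p))]
      with ν hν hlog
    have hlog' : α ≤ max p (1 - p) * Real.log (ν.choose 2) := by
      rw [mul_comm]
      exact (div_le_iff₀ hM).1 hlog
    have hτ : 0 ≤ max p (1 - p) * (ν.choose 2 : ℝ) * Real.log (ν.choose 2)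
        - α * (ν.choose 2 : ℝ) := by
      linarith [mul_le_mul_of_nonneg_right hlog' (Nat.cast_nonneg (α := ℝ) (ν.choose 2))]
    have := cutoffEnvelope_le_worstDist (ι := PotentialEdge ν) hp0 hp1
      (by rw [card_potentialEdge]; exact_mod_cast hν) hα (by rwa [card_potentialEdge])
    rwa [card_potentialEdge] at this
  · refine Eventually.of_forall fun α => ?_
    filter_upwards [tendsto_choose_two.eventually_ge_atTop 2] with ν hν
    have := worstDist_le_cutoffEnvelope (ι := PotentialEdge ν) hp0 hp1
      (by rw [card_potentialEdge]; exact_mod_cast hν) α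
    rwa [card_potentialEdge] at this

end Asymptotic

end MetropolisCutoff

theorem mainTheorem3 (p : ℝ) (hp0 : 0 < p) (hp1 : p < 1) :
    MetropolisCutoff.HasCutoffAt (MetropolisCutoff.erdosRenyiDist p)
      (fun ν : ℕ => max p (1 - p) * (ν.choose 2 : ℝ) * Real.log (ν.choose 2 : ℝ))
      (fun ν : ℕ => (ν.choose 2 : ℝ)) := by
  have hM : 0 < max p (1 - p) := lt_max_of_lt_left hp0
  have hπ : ∀ (ν : ℕ) (x : MetropolisCutoff.GraphSpace ν),
      0 ≤ MetropolisCutoff.erdosRenyi ν p x := fun ν x =>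
    (MetropolisCutoff.bernoulliMass_pos hp0 hp1 x).le
  have hP := fun ν => MetropolisCutoff.lazyMetropolis_mem_rowStochastic (hπ ν)
  have hw := MetropolisCutoff.tendsto_choose_two
  refine (MetropolisCutoff.dropBound_erdosRenyiDist hp0 hp1).hasCutoffAt
    (MetropolisCutoff.tendsto_cutoffEnvelope hp0)
    (MetropolisCutoff.isLittleO_mul_log hM hw) ?_
    (fun ν t => MetropolisCutoff.worstDist_nonneg _ _ t)
    (fun ν t => MetropolisCutoff.worstDist_le_one (hP ν) (hπ ν) t)
    (fun ν => MetropolisCutoff.worstDist_antitone (hP ν) _)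
  exact (hw.const_mul_atTop hM).atTop_mul_atTop₀ (Real.tendsto_log_atTop.comp hw)
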